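/- A (left) brace $(A,+,\circ)$ is a set with an abelian group structure $(A,+)$ and a group structure $(A,\circ)$ such that $a\circ(b+c)+a=a\circ b+a\circ c$ for all $a,b,c\in A$; write $a*b=a\circ b-a-b$. An additive subgroup $I$ of $A$ is an ideal if $i*a\in I$ and $a*i\in I$ for all $i\in I$, $a\in A$. For a prime $p$ and $i\ge 0$ put $p^iA=\{p^ia: a\in A\}$ and $\mathrm{ann}(p^i)=\{a\in A: p^ia=0\}$. An integer $\gamma$ is a primitive root modulo $m$ if every integer coprime to $m$ is congruent modulo $m$ to a power of $\gamma$. A pre-Lie ring $(L,+,\cdot)$ is an abelian group $(L,+)$ with a biadditive operation $\cdot$ such that $(x\cdot y)\cdot z-x\cdot(y\cdot z)=(y\cdot x)\cdot z-y\cdot(x\cdot z)$ for all $x,y,z\in L$. Theorem. Let $(A,+,\circ)$ be a brace of cardinality $p^n$, where $p$ is a prime and $n\geq 1$, and let $k$ be a natural number such that $p^{k(p-1)}A=0$. Assume that $p^iA$ and $\mathrm{ann}(p^i)$ are ideals of $A$ for every $i\ge 0$, and that $a*b\in\mathrm{ann}(p^k)$ for all $a\in p^kA$ and $b\in\mathrm{ann}(p^{2k})$.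 Let $\wp^{-1}:p^kA\to A$ be any function with $p^k\,\wp^{-1}(a)=a$ for all $a\in p^kA$. For $x\in A$ let $[x]$ denote the coset of $x$ in the additive group $A/\mathrm{ann}(p^{2k})$. Then $$[x]\odot[y]=[\wp^{-1}((p^kx)*y)]\qquad(x,y\in A)$$ is a well-defined binary operation on $A/\mathrm{ann}(p^{2k})$. Moreover, let $\gamma$ be a primitive root modulo $p^n$ and let $\xi=\gamma^{p^{n-1}}$. Then $$[x]\bullet[y]=\sum_{i=0}^{p-2}\xi^{p-1-i}\,[\xi^ix]\odot[y]\qquad(x,y\in A)$$ is a well-defined binary operation on $A/\mathrm{ann}(p^{2k})$, and $A/\mathrm{ann}(p^{2k})$ with its addition and $\bullet$ is a pre-Lie ring. -/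

import Mathlib

/-- A (left) brace: an abelian group `(A, +)` and a group `(A, ∘)` on the same set such that
`a ∘ (b + c) + a = a ∘ b + a ∘ c`. The operation `∘` is written as the multiplication `*` of the
`Group` structure. -/
class LeftBrace (A : Type*) extends AddCommGroup A, Group A where
  mul_add_add_self : ∀ a b c : A, a * (b + c) + a = a * b + a * c

namespace LeftBrace

variable {A : Type*} [LeftBrace A]

/-- The derived operation of a brace, `a ∗ b = a ∘ b - a - b`. -/
def ast (a b : A) : A := a * b - a - b

/-- An additive subgroup `I` of a brace is an ideal if `i ∗ a` and `a ∗ i` lie in `I` for all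
`i ∈ I` and all `a`. -/
def IsIdeal (I : AddSubgroup A) : Prop :=
  ∀ i ∈ I, ∀ a : A, ast i a ∈ I ∧ ast a i ∈ I

variable (A)

/-- `p ^ i A = {p ^ i a : a ∈ A}`. -/
def pMultiples (p i : ℕ) : AddSubgroup A := (nsmulAddMonoidHom (α := A) (p ^ i)).range

/-- `ann(p ^ i) = {a ∈ A : p ^ i a = 0}`. -/
def ann (p i : ℕ) : AddSubgroup A := (nsmulAddMonoidHom (α := A) (p ^ i)).ker

end LeftBrace

/-- `γ` is a primitive root modulo `m`: every integer coprime to `m` is congruent to a power of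
`γ` modulo `m`. -/
def IsPrimitiveRootModulo (γ : ℤ) (m : ℕ) : Prop :=
  ∀ a : ℤ, IsCoprime a (m : ℤ) → ∃ j : ℕ, a ≡ γ ^ j [ZMOD (m : ℤ)]

/-- The given abelian group `M` with the binary operation `mul` is a (left) pre-Lie ring: `mul` is
the multiplication of a `LeftPreLieRing` structure whose additive group is the given one. -/
def IsPreLieRing {M : Type*} [inst : AddCommGroup M] (mul : M → M → M) : Prop :=
  ∃ R : LeftPreLieRing M, R.toNonUnitalNonAssocRing.toAddCommGroup = inst ∧
    ∀ x y : M, R.toNonUnitalNonAssocRing.toMul.mul x y = mul x y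

/-!
Write `L_a : b ↦ a ∗ b`. On the filtration `F_j = p ^ (k j) A`, with `F_{p - 1} = 0`, expanding
powers for `∘` by the binomial theorem shows that `a ↦ L_a` is a polynomial map on `F_1`, of degree
less than `p - 1`; the denominators that occur are prime to `p`. The number `ξ` is a primitive
`(p - 1)`-st root of unity modulo `p ^ n`, so the twisted average
`Λ_a = ∑ ξ ^ (p - 1 - i) L_{ξ ^ i a}` isolates the linear part of this map and is therefore
additive in `a ∈ F_1`. The part of bidegree `(1, 1)` of `1 + L_{a ∘ b} = (1 + L_a) (1 + L_b)` says
that `Λ_a Λ_b - Λ_{Λ_a b}` is symmetric in `a` and `b`, which is the pre-Lie identity.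
Multiplication by `p ^ (2 k)` embeds `A / ann(p ^ (2 k))` into `A` and turns `[x] • [y]` into
`p ^ k Λ_{p ^ k x} y`, so the identity passes to the quotient.
-/

theorem eq_zpow_smul {G X : Type*} [Group G] [MulAction G X] {g : G} {f : ℤ → X}
    (hf : ∀ N, f (N + 1) = g • f N) (N : ℤ) : f N = g ^ N • f 0 := by
  induction N with
  | zero => rw [zpow_zero, one_smul]
  | succ i ih => rw [hf, ih, smul_smul, ← zpow_one_add, add_comm]
  | pred i ih =>
    have h := hf (-i - 1)
    rw [sub_add_cancel, ih] at h
    rw [← inv_smul_eq_iff, smul_smul, ← zpow_neg_one, ← zpow_add, neg_add_eq_sub] at h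
    exact h.symm

/-- `∑_{j < J} (N choose j + 1) x ^ j`, which is `((1 + x) ^ N - 1) / x` if `x ^ J = 0`. -/
def binomSum {R : Type*} [Ring R] (J : ℕ) (x : R) (N : ℤ) : R :=
  ∑ j ∈ Finset.range J, Ring.choose N (j + 1) • x ^ j

theorem binomSum_zero {R : Type*} [Ring R] (J : ℕ) (x : R) : binomSum J x 0 = 0 := by
  simp [binomSum, Ring.choose_zero_succ]

theorem binomSum_add_one {R : Type*} [Ring R] {J : ℕ} {x : R} (hx : x ^ J = 0) (N : ℤ) :
    binomSum J x (N + 1) = 1 + binomSum J x N + x * binomSum J x N := by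
  have hmul : x * binomSum J x N = ∑ j ∈ Finset.range J, Ring.choose N (j + 1) • x ^ (j + 1) := by
    simp only [binomSum, Finset.mul_sum, mul_smul_comm, pow_succ']
  have hshift : 1 + x * binomSum J x N = ∑ j ∈ Finset.range J, Ring.choose N j • x ^ j := by
    have h := Finset.sum_range_succ' (fun j => Ring.choose N j • x ^ j) J
    rw [Finset.sum_range_succ, hx, smul_zero, add_zero] at h
    rw [hmul, h, Ring.choose_zero_right, pow_zero, one_smul, add_comm]
  rw [add_right_comm, hshift]
  simp only [binomSum, ← Finset.sum_add_distrib, Ring.choose_succ_succ, add_smul]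

namespace LeftBrace

section Basic

variable {A : Type*} [LeftBrace A]

theorem one_eq_zero : (1 : A) = 0 := by
  have h := mul_add_add_self (1 : A) 0 0
  simpa only [one_mul, add_zero, zero_add] using h

theorem ast_add (a b c : A) : ast a (b + c) = ast a b + ast a c := by
  have h : a * (b + c) = a * b + a * c - a := eq_sub_of_add_eq (mul_add_add_self a b c)
  simp only [ast, h]
  abel

/-- The additive endomorphism `L_a : b ↦ a ∗ b`. -/
def astHom (a : A) : AddMonoid.End A := AddMonoidHom.mk' (ast a) (ast_add a)

theorem astHom_apply (a b : A) : astHom a b = ast a b := rfl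

theorem mul_eq (a b : A) : a * b = a + b + astHom a b := by
  simp only [astHom_apply, ast]
  abel

theorem astHom_mul (a b : A) :
    astHom (a * b) = astHom a + astHom b + astHom a * astHom b := by
  ext c
  have h : a * b + c + astHom (a * b) c =
      a + (b + c + astHom b c) + astHom a (b + c + astHom b c) := by
    rw [← mul_eq, ← mul_eq, ← mul_eq, mul_assoc]
  rw [mul_eq a b, map_add, map_add] at h
  rw [← sub_eq_zero] at h ⊢
  rw [← h]
  change astHom (a * b) c - (astHom a c + astHom b c + astHom a (astHom b c)) = _
  rw [mul_eq]
  abel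

theorem astHom_zero : astHom (0 : A) = 0 := by
  ext c
  have h := mul_eq (0 : A) c
  rw [← one_eq_zero, one_mul, one_eq_zero, zero_add] at h
  exact left_eq_add.1 h

theorem inv_add_self (b : A) : b⁻¹ + b + astHom b⁻¹ b = 0 := by
  rw [← mul_eq, inv_mul_cancel, one_eq_zero]

theorem inv_mul_eq (b y : A) : b⁻¹ * y = (y - b) + astHom b⁻¹ (y - b) := by
  have h := inv_add_self b
  rw [mul_eq, map_sub, ← sub_eq_zero, ← h]
  abel

/-- The action `λ_a : b ↦ a ∘ b - a = b + a ∗ b` of `(A, ∘)` on `(A, +)`. -/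
def lambdaHom : A →* AddMonoid.End A where
  toFun a := 1 + astHom a
  map_one' := by rw [one_eq_zero, astHom_zero, add_zero]
  map_mul' a b := by rw [astHom_mul]; noncomm_ring

theorem zpow_eq_sum {J : ℕ} {a : A} (ha : astHom a ^ J = 0) (N : ℤ) :
    a ^ N = ∑ j ∈ Finset.range J, Ring.choose N (j + 1) • (astHom a ^ j) a := by
  have hsucc : ∀ N, binomSum J (astHom a) (N + 1) a = a • binomSum J (astHom a) N a := fun N => by
    rw [binomSum_add_one ha, smul_eq_mul, mul_eq]
    rfl
  have hzero : binomSum J (astHom a) 0 a = 1 := by rw [binomSum_zero, one_eq_zero]; rfl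
  have hN := eq_zpow_smul (f := fun N => binomSum J (astHom a) N a) hsucc N
  rw [hzero, smul_eq_mul, mul_one] at hN
  exact hN.symm.trans (map_sum (AddMonoidHom.eval a) _ _)

theorem astHom_zpow {J : ℕ} {a : A} (ha : astHom a ^ J = 0) (N : ℤ) :
    astHom (a ^ N) = ∑ j ∈ Finset.range J, Ring.choose N (j + 1) • astHom a ^ (j + 1) := by
  let u := (lambdaHom (A := A)).toHomUnits a
  have hsucc : ∀ N, 1 + binomSum J (astHom a) (N + 1) * astHom a =
      u • (1 + binomSum J (astHom a) N * astHom a) := fun N => by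
    change _ = (1 + astHom a) * (1 + _)
    rw [binomSum_add_one ha]
    noncomm_ring
  have hN : 1 + binomSum J (astHom a) N * astHom a = 1 + astHom (a ^ N) := by
    have h := eq_zpow_smul (f := fun N => 1 + binomSum J (astHom a) N * astHom a) hsucc N
    rw [binomSum_zero, zero_mul, add_zero, ← map_zpow] at h
    exact h.trans (mul_one _)
  rw [← add_left_cancel hN, binomSum, Finset.sum_mul]
  simp only [smul_mul_assoc, pow_succ]

end Basic

end LeftBrace

/-- The endomorphisms that raise the filtration `F` by `i` steps. -/
def endFiltration {M : Type*} [AddCommGroup M] (F : ℕ → AddSubgroup M) (i : ℕ) :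
    AddSubgroup (AddMonoid.End M) where
  carrier := {φ | ∀ j, ∀ a ∈ F j, φ a ∈ F (i + j)}
  zero_mem' _ _ _ := zero_mem _
  add_mem' hφ hψ j a ha := add_mem (hφ j a ha) (hψ j a ha)
  neg_mem' hφ j a ha := neg_mem (hφ j a ha)

section EndFiltration

variable {M : Type*} [AddCommGroup M] {F : ℕ → AddSubgroup M}

theorem endFiltration_antitone (hF : Antitone F) : Antitone (endFiltration F) :=
  fun _ _ hij _ hφ k a ha => hF (Nat.add_le_add_right hij k) (hφ k a ha)

theorem mul_mem_endFiltration {i j : ℕ} {φ ψ : AddMonoid.End M} (hφ : φ ∈ endFiltration F i)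
    (hψ : ψ ∈ endFiltration F j) : φ * ψ ∈ endFiltration F (i + j) :=
  fun k a ha => add_assoc i j k ▸ hφ _ _ (hψ k a ha)

theorem pow_mem_endFiltration {i : ℕ} {φ : AddMonoid.End M} (hφ : φ ∈ endFiltration F i)
    (j : ℕ) : φ ^ j ∈ endFiltration F (j * i) := by
  induction j with
  | zero => exact fun k a ha => by rwa [zero_mul, zero_add]
  | succ j ih => rw [pow_succ, add_mul, one_mul]; exact mul_mem_endFiltration ih hφ

theorem endFiltration_eq_bot (htop : F 0 = ⊤) {m : ℕ} (hm : F m = ⊥) :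
    endFiltration F m = ⊥ := by
  refine (AddSubgroup.eq_bot_iff_forall _).2 fun φ hφ => AddMonoidHom.ext fun a => ?_
  have h := hφ 0 a (htop ▸ AddSubgroup.mem_top a)
  rwa [add_zero, hm, AddSubgroup.mem_bot] at h

end EndFiltration

namespace LeftBrace

variable {A : Type*} [LeftBrace A]

/-- A descending filtration of the additive group of a brace that starts with the whole brace and
is multiplicative for the operation `∗`. -/
structure IsBraceFiltration (F : ℕ → AddSubgroup A) : Prop where
  antitone : Antitone F
  zero_eq_top : F 0 = ⊤
  ast_mem : ∀ i j, ∀ a ∈ F i, ∀ b ∈ F j, ast a b ∈ F (i + j)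

theorem pMultiples_antitone (p : ℕ) : Antitone (pMultiples A p) := by
  rintro i j hij _ ⟨x, rfl⟩
  refine ⟨p ^ (j - i) • x, ?_⟩
  change p ^ i • p ^ (j - i) • x = p ^ j • x
  rw [smul_smul, ← pow_add, Nat.add_sub_cancel' hij]

theorem isBraceFiltration_pMultiples {p k : ℕ}
    (hpow : ∀ i, k ∣ i → IsIdeal (pMultiples A p i)) :
    IsBraceFiltration fun j => pMultiples A p (k * j) where
  antitone _ _ hij := pMultiples_antitone p (Nat.mul_le_mul_left k hij)
  zero_eq_top := (AddSubgroup.eq_top_iff' _).2 fun x => ⟨x, one_nsmul x⟩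
  ast_mem i j a ha _ := by
    rintro ⟨x, rfl⟩
    obtain ⟨y, hy : p ^ (k * i) • y = astHom a x⟩ := (hpow _ ⟨i, rfl⟩ a ha x).1
    refine ⟨y, ?_⟩
    change p ^ (k * (i + j)) • y = astHom a (p ^ (k * j) • x)
    rw [map_nsmul, ← hy, smul_smul, mul_add, pow_add, mul_comm]

namespace IsBraceFiltration

variable {F : ℕ → AddSubgroup A}

theorem astHom_mem (hF : IsBraceFiltration F) {i : ℕ} {a : A} (ha : a ∈ F i) :
    astHom a ∈ endFiltration F i :=
  fun j b hb => hF.ast_mem i j a ha b hb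

theorem astHom_pow_eq_zero (hF : IsBraceFiltration F) {m : ℕ} (hm : F m = ⊥) {a : A}
    (ha : a ∈ F 1) : astHom a ^ m = 0 := by
  have h := pow_mem_endFiltration (hF.astHom_mem ha) m
  rwa [mul_one, endFiltration_eq_bot hF.zero_eq_top hm] at h

end IsBraceFiltration

end LeftBrace

/-! ### Polynomial maps -/

/-- The maps `(ι → ℤ) → M` spanned by the monomial maps `t ↦ P(t) • c` with `P` a homogeneous
polynomial with integer coefficients, where the coefficient `c` lies in the step
`max (deg P) w` of the filtration `F` of `M`. -/
def polyMaps {M : Type*} [AddCommGroup M] (ι : Type*) (F : ℕ → AddSubgroup M) (w : ℕ) :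
    AddSubgroup ((ι → ℤ) → M) :=
  AddSubgroup.closure {f | ∃ (d : ℕ) (P : MvPolynomial ι ℤ) (c : M),
    P.IsHomogeneous d ∧ c ∈ F (max d w) ∧ f = fun t => MvPolynomial.eval t P • c}

theorem exists_nsmul_eq_of_coprime {M : Type*} [AddCommGroup M] {m N : ℕ} (hmN : m.Coprime N)
    {c : M} (hc : N • c = 0) {H : AddSubgroup M} (hcH : c ∈ H) : ∃ c' ∈ H, m • c' = c := by
  obtain ⟨u, v, huv⟩ := Nat.isCoprime_iff_coprime.2 hmN
  refine ⟨u • c, zsmul_mem hcH u, ?_⟩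
  calc m • u • c = (u * m + v * N) • c := by
        rw [add_smul, mul_smul v, natCast_zsmul c N, hc, smul_zero, add_zero, mul_comm, mul_smul,
          natCast_zsmul]
    _ = c := by rw [huv, one_smul]

theorem choose_smul_factorial_nsmul {M : Type*} [AddCommGroup M] (T : ℤ) (j : ℕ) (c : M) :
    Ring.choose T j • j.factorial • c =
      ∑ m ∈ Finset.range (j + 1), T ^ m • (descPochhammer ℤ j).coeff m • c := by
  have h : (j.factorial : ℤ) * Ring.choose T j =
      ∑ m ∈ Finset.range (j + 1), (descPochhammer ℤ j).coeff m * T ^ m := by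
    rw [← nsmul_eq_mul, ← Ring.descPochhammer_eq_factorial_smul_choose,
      ← Polynomial.eval_eq_smeval, Polynomial.eval_eq_sum_range, descPochhammer_natDegree]
  simp only [← natCast_zsmul c, smul_smul, ← Finset.sum_smul]
  rw [mul_comm, h]
  simp only [mul_comm]

namespace polyMaps

variable {ι M N K : Type*} [AddCommGroup M] [AddCommGroup N] [AddCommGroup K]
  {F : ℕ → AddSubgroup M} {w : ℕ}

theorem smul_mem {d : ℕ} {P : MvPolynomial ι ℤ} (hP : P.IsHomogeneous d) {c : M}
    (hc : c ∈ F (max d w)) : (fun t => MvPolynomial.eval t P • c) ∈ polyMaps ι F w :=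
  AddSubgroup.subset_closure ⟨d, P, c, hP, hc, rfl⟩

theorem coord_mem (i : ι) {c : M} (hc : c ∈ F 1) : (fun t => t i • c) ∈ polyMaps ι F 1 := by
  simpa only [MvPolynomial.eval_X] using
    smul_mem (w := 1) (MvPolynomial.isHomogeneous_X ℤ i) hc

theorem const_mem {c : M} (hc : c ∈ F w) : (fun _ => c) ∈ polyMaps ι F w := by
  simpa only [map_one, one_zsmul] using
    smul_mem (w := w) (MvPolynomial.isHomogeneous_one ι ℤ) (c := c) (by rwa [Nat.zero_max])

theorem sum_mem {κ : Type*} (s : Finset κ) {f : κ → (ι → ℤ) → M}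
    (hf : ∀ j ∈ s, f j ∈ polyMaps ι F w) : (fun t => ∑ j ∈ s, f j t) ∈ polyMaps ι F w := by
  simpa only [← Finset.sum_apply] using AddSubgroup.sum_mem _ hf

theorem antitone (hF : Antitone F) : Antitone (polyMaps ι F) := by
  intro v w hvw
  refine AddSubgroup.closure_mono ?_
  rintro f ⟨d, P, c, hP, hc, rfl⟩
  exact ⟨d, P, c, hP, hF (max_le_max_left d hvw) hc, rfl⟩

theorem eq_bot (hF : Antitone F) (hw : F w = ⊥) : polyMaps ι F w = ⊥ := by
  rw [polyMaps, AddSubgroup.closure_eq_bot_iff]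
  rintro f ⟨d, P, c, -, hc, rfl⟩
  have hc0 : c ∈ F w := hF (le_max_right d w) hc
  rw [hw, AddSubgroup.mem_bot] at hc0
  simp only [hc0, smul_zero, Set.mem_singleton_iff]
  rfl

theorem apply_mem_filtration (hF : Antitone F) {f : (ι → ℤ) → M} (hf : f ∈ polyMaps ι F w)
    (t : ι → ℤ) : f t ∈ F w := by
  suffices h : polyMaps ι F w ≤ (F w).comap (Pi.evalAddMonoidHom (fun _ : ι → ℤ => M) t) from h hf
  refine (AddSubgroup.closure_le _).2 ?_
  rintro f ⟨d, P, c, -, hc, rfl⟩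
  exact zsmul_mem (hF (le_max_right d w) hc) _

theorem bilin_mem {G : ℕ → AddSubgroup N} {H : ℕ → AddSubgroup K} (hH : Antitone H)
    (B : M →+ N →+ K) (hB : ∀ i j, ∀ x ∈ F i, ∀ y ∈ G j, B x y ∈ H (i + j)) {v : ℕ}
    {f : (ι → ℤ) → M} {g : (ι → ℤ) → N} (hf : f ∈ polyMaps ι F v) (hg : g ∈ polyMaps ι G w) :
    (fun t => B (f t) (g t)) ∈ polyMaps ι H (v + w) := by
  have hmon : ∀ (d : ℕ) (P : MvPolynomial ι ℤ) (c : M), P.IsHomogeneous d → c ∈ F (max d v) →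
      (fun t => B (MvPolynomial.eval t P • c) (g t)) ∈ polyMaps ι H (v + w) := by
    intro d P c hP hc
    induction hg using AddSubgroup.closure_induction with
    | mem _ hg =>
      obtain ⟨e, Q, c', hQ, hc', rfl⟩ := hg
      have h := smul_mem (w := v + w) (hQ.mul hP)
        (hH (show max (e + d) (v + w) ≤ max d v + max e w by omega) (hB _ _ c hc c' hc'))
      simpa only [map_mul, mul_smul, map_zsmul, AddMonoidHom.coe_smul, Pi.smul_apply] using h
    | zero => simp only [Pi.zero_apply, map_zero]; exact zero_mem _
    | add _ _ _ _ h h' => simp only [Pi.add_apply, map_add]; exact add_mem h h'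
    | neg _ _ h => simp only [Pi.neg_apply, map_neg]; exact neg_mem h
  induction hf using AddSubgroup.closure_induction with
  | mem _ hf => obtain ⟨d, P, c, hP, hc, rfl⟩ := hf; exact hmon d P c hP hc
  | zero => simp only [Pi.zero_apply, map_zero]; exact zero_mem _
  | add _ _ _ _ h h' => simp only [Pi.add_apply, map_add]; exact add_mem h h'
  | neg _ _ h => simp only [Pi.neg_apply, map_neg]; exact neg_mem h

theorem apply_mem (hF : Antitone F) {v : ℕ} {φ : (ι → ℤ) → AddMonoid.End M} {g : (ι → ℤ) → M}
    (hφ : φ ∈ polyMaps ι (endFiltration F) v) (hg : g ∈ polyMaps ι F w) :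
    (fun t => φ t (g t)) ∈ polyMaps ι F (v + w) :=
  bilin_mem hF (AddMonoidHom.mk' (fun φ : AddMonoid.End M => (φ : M →+ M)) fun _ _ => rfl)
    (fun _ j φ (hφ : φ ∈ endFiltration F _) x hx => hφ j x hx) hφ hg

theorem mul_mem (hF : Antitone F) {v : ℕ} {φ ψ : (ι → ℤ) → AddMonoid.End M}
    (hφ : φ ∈ polyMaps ι (endFiltration F) v) (hψ : ψ ∈ polyMaps ι (endFiltration F) w) :
    (fun t => φ t * ψ t) ∈ polyMaps ι (endFiltration F) (v + w) :=
  bilin_mem (endFiltration_antitone hF) AddMonoidHom.mul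
    (fun _ _ _ hφ _ hψ => mul_mem_endFiltration hφ hψ) hφ hψ

theorem pow_succ_mem (hF : Antitone F) {φ : (ι → ℤ) → AddMonoid.End M}
    (hφ : φ ∈ polyMaps ι (endFiltration F) w) (j : ℕ) :
    (fun t => φ t ^ (j + 1)) ∈ polyMaps ι (endFiltration F) w := by
  induction j with
  | zero => simpa only [zero_add, pow_one] using hφ
  | succ j ih =>
    simp only [pow_succ _ (j + 1)]
    exact antitone (endFiltration_antitone hF) (Nat.le_add_right w w) (mul_mem hF ih hφ)

theorem choose_mem (hF : Antitone F) {p n : ℕ} (hp : p.Prime) (hM : ∀ x : M, p ^ n • x = 0)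
    {j : ℕ} (hj : j < p) {d : ℕ} {P : MvPolynomial ι ℤ} (hP : P.IsHomogeneous d) {c : M}
    (hc : c ∈ F (max (j * d) w)) :
    (fun t => Ring.choose (MvPolynomial.eval t P) j • c) ∈ polyMaps ι F w := by
  obtain ⟨c, hc', rfl⟩ := exists_nsmul_eq_of_coprime
    ((hp.coprime_factorial_of_lt hj).symm.pow_right n) (hM c) hc
  simp only [choose_smul_factorial_nsmul, ← map_pow]
  refine sum_mem _ fun m hm => smul_mem (hP.pow m) (zsmul_mem (hF ?_ hc') _)
  have hmj : m ≤ j := Nat.lt_succ_iff.1 (Finset.mem_range.1 hm)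
  exact max_le_max_right w ((Nat.mul_comm d m).trans_le (Nat.mul_le_mul_right d hmj))

end polyMaps

/-! ### Polynomiality of `a ↦ L_a` -/

theorem nsmul_end_eq_zero {M : Type*} [AddCommGroup M] {N : ℕ} (hM : ∀ x : M, N • x = 0)
    (φ : AddMonoid.End M) : N • φ = 0 :=
  AddMonoidHom.ext fun x => hM (φ x)

namespace LeftBrace.IsBraceFiltration

open MvPolynomial

variable {A ι : Type*} [LeftBrace A] {F : ℕ → AddSubgroup A} {w : ℕ}

theorem astHom_zpow_eval_mem (hF : IsBraceFiltration F) {p n : ℕ} (hp : p.Prime)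
    (hA : ∀ x : A, p ^ n • x = 0) (hbot : F (p - 1) = ⊥) (hw : 1 ≤ w) {d : ℕ}
    {P : MvPolynomial ι ℤ} (hP : P.IsHomogeneous d) {c : A} (hc : c ∈ F (max d w)) :
    (fun t => astHom (c ^ eval t P)) ∈ polyMaps ι (endFiltration F) w := by
  have hc1 : c ∈ F 1 := hF.antitone (hw.trans (le_max_right d w)) hc
  simp only [astHom_zpow (hF.astHom_pow_eq_zero hbot hc1)]
  refine polyMaps.sum_mem _ fun j hj => ?_
  have hjp : j < p - 1 := Finset.mem_range.1 hj
  refine polyMaps.choose_mem (endFiltration_antitone hF.antitone) hp (nsmul_end_eq_zero hA)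
    (by omega) hP (endFiltration_antitone hF.antitone ?_
      (pow_mem_endFiltration (hF.astHom_mem hc) (j + 1)))
  exact max_le (Nat.mul_le_mul_left _ (le_max_left d w))
    ((le_max_right d w).trans (Nat.le_mul_of_pos_left _ j.succ_pos))

theorem zpow_eval_sub_smul_mem (hF : IsBraceFiltration F) {p n : ℕ} (hp : p.Prime)
    (hA : ∀ x : A, p ^ n • x = 0) (hbot : F (p - 1) = ⊥) (hw : 1 ≤ w) {d : ℕ}
    {P : MvPolynomial ι ℤ} (hP : P.IsHomogeneous d) {c : A} (hc : c ∈ F (max d w)) :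
    (fun t => c ^ eval t P - eval t P • c) ∈ polyMaps ι F (w + 1) := by
  have hc1 : c ∈ F 1 := hF.antitone (hw.trans (le_max_right d w)) hc
  have hexpand : ∀ N : ℤ, c ^ N - N • c =
      ∑ j ∈ Finset.range (p - 2), Ring.choose N (j + 2) • (astHom c ^ (j + 1)) c := fun N => by
    have hp2 : p - 1 = p - 2 + 1 := by have := hp.two_le; omega
    rw [zpow_eq_sum (hF.astHom_pow_eq_zero hbot hc1), hp2, Finset.sum_range_succ', zero_add,
      Ring.choose_one_right, pow_zero, AddMonoid.End.one_apply, add_sub_cancel_right]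
  simp only [hexpand]
  refine polyMaps.sum_mem _ fun j hj => ?_
  have hjp : j < p - 2 := Finset.mem_range.1 hj
  refine polyMaps.choose_mem hF.antitone hp hA (by omega) hP (hF.antitone ?_
    (pow_mem_endFiltration (hF.astHom_mem hc) (j + 1) _ c hc))
  rw [← Nat.succ_mul]
  refine max_le (Nat.mul_le_mul_left _ (le_max_left d w)) ?_
  calc w + 1 ≤ (j + 2) * w := by nlinarith
    _ ≤ (j + 2) * max d w := Nat.mul_le_mul_left _ (le_max_right d w)

theorem astHom_inv_comp_mem (hF : IsBraceFiltration F) {m : ℕ} (hbot : F m = ⊥) (hw : 1 ≤ w)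
    {x : (ι → ℤ) → A} (hx : x ∈ polyMaps ι F w)
    (hLx : (fun t => astHom (x t)) ∈ polyMaps ι (endFiltration F) w) :
    (fun t => astHom (x t)⁻¹) ∈ polyMaps ι (endFiltration F) w := by
  have hx1 : ∀ t, x t ∈ F 1 := fun t =>
    hF.antitone hw (polyMaps.apply_mem_filtration hF.antitone hx t)
  simp only [← zpow_neg_one, fun t => astHom_zpow (hF.astHom_pow_eq_zero hbot (hx1 t))]
  exact polyMaps.sum_mem _ fun j _ => zsmul_mem (polyMaps.pow_succ_mem hF.antitone hLx j) _

/-- Since `y = x ∘ e` with `e = x⁻¹ ∘ y` of weight `w + 1`, `L_y` can be computed from `L_x` and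
`L_e`. -/
theorem astHom_comp_mem_of_sub_mem (hF : IsBraceFiltration F) {m : ℕ} (hbot : F m = ⊥)
    (hw : 1 ≤ w) (hsucc : ∀ g ∈ polyMaps ι F (w + 1),
      (fun t => astHom (g t)) ∈ polyMaps ι (endFiltration F) (w + 1))
    {x y : (ι → ℤ) → A} (hLx : (fun t => astHom (x t)) ∈ polyMaps ι (endFiltration F) w)
    (hy : y ∈ polyMaps ι F w) (hxy : (fun t => x t - y t) ∈ polyMaps ι F (w + 1)) :
    (fun t => astHom (y t)) ∈ polyMaps ι (endFiltration F) w := by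
  have hE := polyMaps.antitone (ι := ι) (endFiltration_antitone hF.antitone)
  have hP := polyMaps.antitone (ι := ι) hF.antitone
  have hyx : y - x ∈ polyMaps ι F (w + 1) := by
    rw [← neg_sub]
    exact neg_mem hxy
  have hx : x ∈ polyMaps ι F w := by
    rw [← sub_add_cancel x y]
    exact add_mem (hP (Nat.le_succ w) hxy) hy
  have he : (fun t => (x t)⁻¹ * y t) ∈ polyMaps ι F (w + 1) := by
    simp only [inv_mul_eq]
    exact add_mem hyx (hP (Nat.le_add_left _ _)
      (polyMaps.apply_mem hF.antitone (hF.astHom_inv_comp_mem hbot hw hx hLx) hyx))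
  have hLe := hE (Nat.le_succ w) (hsucc _ he)
  have hLy : ∀ t, astHom (y t) = astHom (x t) + astHom ((x t)⁻¹ * y t) +
      astHom (x t) * astHom ((x t)⁻¹ * y t) := fun t => by rw [← astHom_mul, mul_inv_cancel_left]
  simp only [hLy]
  exact add_mem (add_mem hLx hLe)
    (hE (Nat.le_add_right w w) (polyMaps.mul_mem hF.antitone hLx hLe))

theorem astHom_comp_mem (hF : IsBraceFiltration F) {p n : ℕ} (hp : p.Prime)
    (hA : ∀ x : A, p ^ n • x = 0) (hbot : F (p - 1) = ⊥) {w : ℕ} (hw : 1 ≤ w)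
    {g : (ι → ℤ) → A} (hg : g ∈ polyMaps ι F w) :
    (fun t => astHom (g t)) ∈ polyMaps ι (endFiltration F) w := by
  by_cases hwp : p - 1 ≤ w
  · rw [polyMaps.eq_bot hF.antitone (eq_bot_iff.2 (hbot ▸ hF.antitone hwp)),
      AddSubgroup.mem_bot] at hg
    simp only [hg, Pi.zero_apply, astHom_zero]
    exact zero_mem _
  have hclose {x y : (ι → ℤ) → A} := hF.astHom_comp_mem_of_sub_mem hbot hw (x := x) (y := y)
    fun _ hg => hF.astHom_comp_mem hp hA hbot (Nat.le_succ_of_le hw) hg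
  have hweight := polyMaps.antitone (ι := ι) hF.antitone (Nat.add_le_add_left hw w)
  induction hg using AddSubgroup.closure_induction with
  | mem _ hg =>
    obtain ⟨d, P, c, hP, hc, rfl⟩ := hg
    exact hclose (hF.astHom_zpow_eval_mem hp hA hbot hw hP hc) (polyMaps.smul_mem hP hc)
      (hF.zpow_eval_sub_smul_mem hp hA hbot hw hP hc)
  | zero =>
    simp only [Pi.zero_apply, astHom_zero]
    exact zero_mem _
  | add x y hx hy hLx hLy =>
    refine hclose (x := fun t => x t * y t) ?_ (add_mem hx hy) ?_
    · simp only [astHom_mul]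
      exact add_mem (add_mem hLx hLy) (polyMaps.antitone (endFiltration_antitone hF.antitone)
        (Nat.le_add_right w w) (polyMaps.mul_mem hF.antitone hLx hLy))
    · simp only [mul_eq, Pi.add_apply, add_sub_cancel_left]
      exact hweight (polyMaps.apply_mem hF.antitone hLx hy)
  | neg x hx hLx =>
    have hLx' := hF.astHom_inv_comp_mem hbot hw hx hLx
    refine hclose (x := fun t => (x t)⁻¹) hLx' (neg_mem hx) ?_
    have hinv : ∀ t, (x t)⁻¹ - (-x) t = -astHom (x t)⁻¹ (x t) := fun t => by
      rw [Pi.neg_apply, sub_neg_eq_add, eq_neg_iff_add_eq_zero, inv_add_self]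
    simp only [hinv]
    exact neg_mem (hweight (polyMaps.apply_mem hF.antitone hLx' hx))
termination_by p - 1 - w

end LeftBrace.IsBraceFiltration

/-! ### Averaging over roots of unity -/

section TwistedAvg

variable {M N : Type*} [AddCommGroup M] [AddCommGroup N]

/-- The twisted average `∑_{r < m} ξ ^ (m - r) h (ξ ^ r)`. If `ξ` is a primitive `m`-th root of
unity, it extracts `m` times the linear coefficient of a polynomial map `h` of degree less than
`m`. -/
def twistedAvg (m : ℕ) (ξ : ℤ) (h : ℤ → M) : M :=
  ∑ r ∈ Finset.range m, ξ ^ (m - r) • h (ξ ^ r)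

/-- The averages `twistedAvg m ξ` kill, modulo `q`, the constants and the monomials of degree less
than `m` except those of degree one. (There is no condition for `m = 1`.) -/
def ExtractsLinear (m q : ℕ) (ξ : ℤ) : Prop :=
  ∀ d, d ≠ 1 → max d 1 < m → (q : ℤ) ∣ ∑ r ∈ Finset.range m, ξ ^ (m - r) * (ξ ^ r) ^ d

variable {m q : ℕ} {ξ : ℤ}

theorem twistedAvg_add (f g : ℤ → M) :
    twistedAvg m ξ (fun s => f s + g s) = twistedAvg m ξ f + twistedAvg m ξ g := by
  simp only [twistedAvg, smul_add, Finset.sum_add_distrib]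

theorem map_twistedAvg (φ : M →+ N) (f : ℤ → M) :
    φ (twistedAvg m ξ f) = twistedAvg m ξ fun s => φ (f s) := by
  simp only [twistedAvg, map_sum, map_zsmul]

theorem twistedAvg_zero : twistedAvg m ξ (fun _ => (0 : M)) = 0 := by
  simp only [twistedAvg, smul_zero, Finset.sum_const_zero]

theorem twistedAvg_neg (f : ℤ → M) : twistedAvg m ξ (fun s => -f s) = -twistedAvg m ξ f := by
  simp only [twistedAvg, smul_neg, Finset.sum_neg_distrib]

theorem twistedAvg_comm (f : ℤ → ℤ → M) :
    (twistedAvg m ξ fun s => twistedAvg m ξ fun t => f s t) =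
      twistedAvg m ξ fun t => twistedAvg m ξ fun s => f s t := by
  simp only [twistedAvg, Finset.smul_sum]
  rw [Finset.sum_comm]
  exact Finset.sum_congr rfl fun _ _ => Finset.sum_congr rfl fun _ _ => smul_comm _ _ _

theorem twistedAvg_mul_twistedAvg {R : Type*} [Ring R] (f g : ℤ → R) :
    twistedAvg m ξ f * twistedAvg m ξ g =
      twistedAvg m ξ fun t => twistedAvg m ξ fun s => f s * g t := by
  refine (map_twistedAvg (AddMonoidHom.mulLeft (twistedAvg m ξ f)) g).trans ?_
  exact congrArg (twistedAvg m ξ) (funext fun t => map_twistedAvg (AddMonoidHom.mulRight (g t)) f)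

theorem twistedAvg_mem {H : AddSubgroup M} {f : ℤ → M} (hf : ∀ s, f s ∈ H) :
    twistedAvg m ξ f ∈ H :=
  sum_mem fun _ _ => zsmul_mem (hf _) _

variable {F : ℕ → AddSubgroup M}

theorem twistedAvg_pow_smul (hF : Antitone F) (hbot : F m = ⊥) (hM : ∀ x : M, q • x = 0)
    (hξ : ExtractsLinear m q ξ) {d : ℕ} (hd : d ≠ 1) {c : M} (hc : c ∈ F (max d 1)) :
    (twistedAvg m ξ fun s => s ^ d • c) = 0 := by
  by_cases hdm : max d 1 < m
  · obtain ⟨u, hu⟩ := hξ d hd hdm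
    simp only [twistedAvg, smul_smul, ← Finset.sum_smul]
    rw [hu, mul_smul, natCast_zsmul, hM]
  · have hc0 := hF (not_lt.1 hdm) hc
    rw [hbot, AddSubgroup.mem_bot] at hc0
    simp only [hc0, smul_zero, twistedAvg_zero]

theorem twistedAvg_const (hF : Antitone F) (hbot : F m = ⊥) (hM : ∀ x : M, q • x = 0)
    (hξ : ExtractsLinear m q ξ) {c : M} (hc : c ∈ F 1) : (twistedAvg m ξ fun _ => c) = 0 := by
  simpa only [pow_zero, one_zsmul] using twistedAvg_pow_smul hF hbot hM hξ zero_ne_one hc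

end TwistedAvg

section EvalHomogeneous

open MvPolynomial

variable {ι R : Type*} [CommRing R] {P : MvPolynomial ι R}

theorem eval_smul_of_isHomogeneous {d : ℕ} (hP : P.IsHomogeneous d) (s : R) (t : ι → R) :
    eval (s • t) P = s ^ d * eval t P := by
  rw [eval_eq, eval_eq, Finset.mul_sum]
  refine Finset.sum_congr rfl fun β hβ => ?_
  have hdeg : ∑ i ∈ β.support, β i = d := by
    rw [← Finsupp.degree_apply, Finsupp.degree_eq_weight_one]
    exact hP (mem_support_iff.1 hβ)
  simp only [Pi.smul_apply, smul_eq_mul, mul_pow, Finset.prod_mul_distrib,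
    Finset.prod_pow_eq_pow_sum, hdeg]
  ring

theorem eval_add_of_isHomogeneous_one (hP : P.IsHomogeneous 1) (t u : ι → R) :
    eval (t + u) P = eval t P + eval u P := by
  rw [← mem_homogeneousSubmodule, homogeneousSubmodule_one_eq_span_X] at hP
  induction hP using Submodule.span_induction with
  | mem _ h => obtain ⟨i, rfl⟩ := h; simp only [eval_X, Pi.add_apply]
  | zero => simp only [map_zero, add_zero]
  | add P Q _ _ hP hQ => simp only [map_add, hP, hQ, add_add_add_comm]
  | smul r P _ hP => simp only [smul_eval, hP, mul_add]

end EvalHomogeneous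

theorem twistedAvg_smul_add {M ι : Type*} [AddCommGroup M] {m q : ℕ} {ξ : ℤ}
    {F : ℕ → AddSubgroup M} (hF : Antitone F) (hbot : F m = ⊥) (hM : ∀ x : M, q • x = 0)
    (hξ : ExtractsLinear m q ξ) {f : (ι → ℤ) → M} (hf : f ∈ polyMaps ι F 1) (t u : ι → ℤ) :
    (twistedAvg m ξ fun s => f (s • (t + u))) =
      (twistedAvg m ξ fun s => f (s • t)) + twistedAvg m ξ fun s => f (s • u) := by
  induction hf using AddSubgroup.closure_induction with
  | mem _ hf =>
    obtain ⟨d, P, c, hP, hc, rfl⟩ := hf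
    simp only [eval_smul_of_isHomogeneous hP, mul_smul]
    by_cases hd : d = 1
    · subst hd
      simp only [eval_add_of_isHomogeneous_one hP, add_smul, smul_add, twistedAvg_add]
    · have hvanish : ∀ v : ι → ℤ,
          (twistedAvg m ξ fun s => s ^ d • MvPolynomial.eval v P • c) = 0 := fun v =>
        twistedAvg_pow_smul hF hbot hM hξ hd (zsmul_mem hc _)
      simp only [hvanish, add_zero]
  | zero => simp only [Pi.zero_apply, twistedAvg_zero, add_zero]
  | add f g _ _ hf hg => simp only [Pi.add_apply, twistedAvg_add, hf, hg, add_add_add_comm]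
  | neg f _ hf => simp only [Pi.neg_apply, twistedAvg_neg, hf, neg_add]

/-! ### The linear part of `a ↦ L_a` -/

namespace LeftBrace

variable {A : Type*} [LeftBrace A] {m : ℕ} {ξ : ℤ}

/-- The twisted average `Λ_a = ∑_{r < m} ξ ^ (m - r) L_{ξ ^ r a}`, a multiple of the linear part
of `a ↦ L_a`. -/
def linAst (m : ℕ) (ξ : ℤ) (a : A) : AddMonoid.End A :=
  twistedAvg m ξ fun s => astHom (s • a)

theorem linAst_apply (a b : A) : linAst m ξ a b = twistedAvg m ξ fun s => ast (s • a) b :=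
  map_twistedAvg (AddMonoidHom.eval b : AddMonoid.End A →+ A) _

namespace IsBraceFiltration

variable {F : ℕ → AddSubgroup A} {p n : ℕ}

theorem linAst_mem (hF : IsBraceFiltration F) {i : ℕ} {a : A} (ha : a ∈ F i) :
    linAst m ξ a ∈ endFiltration F i :=
  twistedAvg_mem fun s => hF.astHom_mem (zsmul_mem ha s)

theorem twistedAvg_const_end (hF : IsBraceFiltration F) {q : ℕ} (hA : ∀ x : A, q • x = 0)
    (hbot : F m = ⊥) (hξ : ExtractsLinear m q ξ) {φ : AddMonoid.End A}
    (hφ : φ ∈ endFiltration F 1) : (twistedAvg m ξ fun _ => φ) = 0 :=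
  twistedAvg_const (endFiltration_antitone hF.antitone) (endFiltration_eq_bot hF.zero_eq_top hbot)
    (nsmul_end_eq_zero hA) hξ hφ

theorem twistedAvg_astHom_mul (hF : IsBraceFiltration F) {q : ℕ} (hA : ∀ x : A, q • x = 0)
    (hbot : F m = ⊥) (hξ : ExtractsLinear m q ξ) {a b : A} (ha : a ∈ F 1) (hb : b ∈ F 1) :
    (twistedAvg m ξ fun t => twistedAvg m ξ fun s => astHom ((s • a) * (t • b))) =
      linAst m ξ a * linAst m ξ b := by
  have hleft : (twistedAvg m ξ fun _ => twistedAvg m ξ fun s => astHom (s • a)) = 0 :=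
    hF.twistedAvg_const_end hA hbot hξ (hF.linAst_mem ha)
  have hright (t : ℤ) : (twistedAvg m ξ fun _ => astHom (t • b)) = 0 :=
    hF.twistedAvg_const_end hA hbot hξ (hF.astHom_mem (zsmul_mem hb t))
  simp only [astHom_mul, twistedAvg_add, hleft, hright, twistedAvg_zero, zero_add]
  exact (twistedAvg_mul_twistedAvg (R := AddMonoid.End A) _ _).symm

variable (hF : IsBraceFiltration F) (hp : p.Prime) (hA : ∀ x : A, p ^ n • x = 0)
  (hbot : F (p - 1) = ⊥) (hξ : ExtractsLinear (p - 1) (p ^ n) ξ) {a b : A}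

include hF hp hA hbot hξ

theorem twistedAvg_astHom_smul_add {ι : Type*} {g : (ι → ℤ) → A} (hg : g ∈ polyMaps ι F 1)
    (t u : ι → ℤ) :
    (twistedAvg (p - 1) ξ fun s => astHom (g (s • (t + u)))) =
      (twistedAvg (p - 1) ξ fun s => astHom (g (s • t))) +
        twistedAvg (p - 1) ξ fun s => astHom (g (s • u)) :=
  twistedAvg_smul_add (endFiltration_antitone hF.antitone)
    (endFiltration_eq_bot hF.zero_eq_top hbot) (nsmul_end_eq_zero hA) hξ
    (hF.astHom_comp_mem hp hA hbot le_rfl hg) t u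

theorem linAst_add (ha : a ∈ F 1) (hb : b ∈ F 1) :
    linAst (p - 1) ξ (a + b) = linAst (p - 1) ξ a + linAst (p - 1) ξ b := by
  have h := hF.twistedAvg_astHom_smul_add hp hA hbot hξ
    (add_mem (polyMaps.coord_mem (0 : Fin 2) ha) (polyMaps.coord_mem 1 hb)) ![1, 0] ![0, 1]
  simpa [linAst] using h

/-- `a ↦ Λ_a`, which is additive on the first step of the filtration. -/
def linAstHom : F 1 →+ AddMonoid.End A :=
  AddMonoidHom.mk' (fun a => linAst (p - 1) ξ (a : A)) fun a b =>
    hF.linAst_add hp hA hbot hξ a.2 b.2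

theorem linAst_nsmul (ha : a ∈ F 1) (N : ℕ) :
    linAst (p - 1) ξ (N • a) = N • linAst (p - 1) ξ a :=
  map_nsmul (hF.linAstHom hp hA hbot hξ) N (⟨a, ha⟩ : F 1)

theorem linAst_twistedAvg (f : ℤ → F 1) :
    linAst (p - 1) ξ (twistedAvg m ξ fun s => (f s : A)) =
      twistedAvg m ξ fun s => linAst (p - 1) ξ (f s : A) := by
  have hcoe : ((twistedAvg m ξ f : F 1) : A) = twistedAvg m ξ fun s => (f s : A) :=
    map_twistedAvg (F 1).subtype f
  rw [← hcoe]
  exact map_twistedAvg (hF.linAstHom hp hA hbot hξ) f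

theorem twistedAvg_linAst_add_ast (ha : a ∈ F 1) (hb : b ∈ F 1) :
    (twistedAvg (p - 1) ξ fun s => linAst (p - 1) ξ (b + ast (s • a) b)) =
      linAst (p - 1) ξ (linAst (p - 1) ξ a b) := by
  have hab (s : ℤ) : ast (s • a) b ∈ F 1 :=
    hF.antitone (Nat.le_add_right 1 1) (hF.ast_mem 1 1 _ (zsmul_mem ha s) b hb)
  have hadd (s : ℤ) := hF.linAst_add hp hA hbot hξ hb (hab s)
  simp only [hadd, twistedAvg_add, hF.twistedAvg_const_end hA hbot hξ (hF.linAst_mem hb), zero_add,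
    linAst_apply]
  exact (hF.linAst_twistedAvg hp hA hbot hξ fun s => ⟨_, hab s⟩).symm

theorem twistedAvg_astHom_smul_mul_smul (ha : a ∈ F 1) (hb : b ∈ F 1) (t : ℤ) :
    (twistedAvg (p - 1) ξ fun s => astHom ((s • a) * (t • b))) =
      (twistedAvg (p - 1) ξ fun s => astHom (s • a + t • b)) +
        twistedAvg (p - 1) ξ fun s => astHom (t • (b + ast (s • a) b)) := by
  have htb : t • b ∈ F 1 := zsmul_mem hb t
  have hLa : (fun u : Fin 2 → ℤ => astHom (u 1 • a)) ∈ polyMaps (Fin 2) (endFiltration F) 1 :=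
    hF.astHom_comp_mem hp hA hbot le_rfl (polyMaps.coord_mem 1 ha)
  have hLab : (fun u : Fin 2 → ℤ => astHom (u 1 • a) (t • b)) ∈ polyMaps (Fin 2) F 1 :=
    polyMaps.antitone hF.antitone (Nat.le_add_right 1 1)
      (polyMaps.apply_mem hF.antitone hLa (polyMaps.const_mem htb))
  have h := hF.twistedAvg_astHom_smul_add hp hA hbot hξ
    (add_mem (add_mem (polyMaps.coord_mem (0 : Fin 2) ha) (polyMaps.const_mem htb)) hLab)
    ![1, 0] ![0, 1]
  simp only [mul_eq, smul_add, ← astHom_apply, ← map_zsmul]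
  simpa [astHom_zero] using h

/-- The part of bidegree `(1, 1)` in `a` and `b` of `L_{a ∘ b} = L_a + L_b + L_a L_b`, where
`a ∘ b = a + b + L_a b`. -/
theorem linAst_mul_linAst (ha : a ∈ F 1) (hb : b ∈ F 1) :
    linAst (p - 1) ξ a * linAst (p - 1) ξ b =
      (twistedAvg (p - 1) ξ fun t => twistedAvg (p - 1) ξ fun s => astHom (s • a + t • b)) +
        linAst (p - 1) ξ (linAst (p - 1) ξ a b) := by
  rw [← hF.twistedAvg_astHom_mul hA hbot hξ ha hb,
    ← hF.twistedAvg_linAst_add_ast hp hA hbot hξ ha hb]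
  simp only [hF.twistedAvg_astHom_smul_mul_smul hp hA hbot hξ ha hb, twistedAvg_add]
  exact congrArg _ (twistedAvg_comm _)

theorem linAst_linAst_sub_symm (ha : a ∈ F 1) (hb : b ∈ F 1) :
    linAst (p - 1) ξ (linAst (p - 1) ξ a b) - linAst (p - 1) ξ a * linAst (p - 1) ξ b =
      linAst (p - 1) ξ (linAst (p - 1) ξ b a) - linAst (p - 1) ξ b * linAst (p - 1) ξ a := by
  rw [hF.linAst_mul_linAst hp hA hbot hξ ha hb, hF.linAst_mul_linAst hp hA hbot hξ hb ha,
    twistedAvg_comm, sub_add_cancel_right, sub_add_cancel_right]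
  simp only [add_comm]

end IsBraceFiltration

end LeftBrace

/-! ### Primitive roots -/

theorem extractsLinear_of_isUnit {m q : ℕ} {ξ : ℤ} (hone : (ξ : ZMod q) ^ m = 1)
    (hunit : ∀ j, 0 < j → j < m → IsUnit ((ξ : ZMod q) ^ j - 1)) : ExtractsLinear m q ξ := by
  intro d hd hdm
  set x := (ξ : ZMod q)
  have hterm : ∀ r ∈ Finset.range m, x ^ (m - r) * (x ^ r) ^ d = (x ^ (m - 1 + d)) ^ r := by
    rintro (_ | r) hr
    · simp only [Nat.sub_zero, hone, pow_zero, one_pow, mul_one]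
    · obtain ⟨e, rfl⟩ := Nat.exists_eq_add_of_lt (Finset.mem_range.1 hr)
      calc x ^ (r + 1 + e + 1 - (r + 1)) * (x ^ (r + 1)) ^ d
          = (x ^ (r + 1 + e + 1)) ^ r * x ^ (e + 1) * (x ^ (r + 1)) ^ d := by
            rw [hone, one_pow, one_mul, Nat.add_assoc (r + 1), Nat.add_sub_cancel_left]
        _ = (x ^ (r + 1 + e + 1 - 1 + d)) ^ (r + 1) := by rw [Nat.add_sub_cancel]; ring
  have hv : IsUnit (x ^ (m - 1 + d) - 1) := by
    rcases Nat.eq_zero_or_pos d with rfl | hd0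
    · exact hunit _ (by omega) (by omega)
    · rw [show m - 1 + d = m + (d - 1) by omega, pow_add, hone, one_mul]
      exact hunit _ (by omega) (by omega)
  have hroot : (x ^ (m - 1 + d)) ^ m = 1 := by rw [pow_right_comm, hone, one_pow]
  rw [← ZMod.intCast_zmod_eq_zero_iff_dvd]
  push_cast
  rw [Finset.sum_congr rfl hterm, ← hv.mul_left_eq_zero, geom_sum_mul, hroot, sub_self]

theorem isUnit_intCast_zmod_pow {m : ℕ} (n : ℕ) {z : ℤ} (hz : IsUnit (z : ZMod m)) :
    IsUnit (z : ZMod (m ^ n)) := by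
  rw [ZMod.coe_int_isUnit_iff_isCoprime] at hz ⊢
  rw [Nat.cast_pow]
  exact hz.pow_left

namespace IsPrimitiveRootModulo

variable {γ : ℤ} {m : ℕ}

theorem of_pow {n : ℕ} (hn : n ≠ 0) (hγ : IsPrimitiveRootModulo γ (m ^ n)) :
    IsPrimitiveRootModulo γ m := fun a ha => by
  have hmn : (m : ℤ) ∣ (m ^ n : ℕ) := Int.natCast_dvd_natCast.2 (dvd_pow_self m hn)
  obtain ⟨j, hj⟩ := hγ a (by rw [Nat.cast_pow]; exact ha.pow_right)
  exact ⟨j, hj.of_dvd hmn⟩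

theorem exists_eq_pow (hγ : IsPrimitiveRootModulo γ m) (u : (ZMod m)ˣ) :
    ∃ j : ℕ, (u : ZMod m) = (γ : ZMod m) ^ j := by
  obtain ⟨a, ha⟩ := ZMod.intCast_surjective (u : ZMod m)
  obtain ⟨j, hj⟩ := hγ a ((ZMod.coe_int_isUnit_iff_isCoprime a m).1 (ha ▸ u.isUnit)).symm
  exact ⟨j, by rw [← ha, ← Int.cast_pow, ZMod.intCast_eq_intCast_iff]; exact hj⟩

theorem isUnit (hγ : IsPrimitiveRootModulo γ m) (hm : 2 < m) : IsUnit (γ : ZMod m) := by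
  have := Fact.mk hm
  obtain ⟨j, hj⟩ := hγ.exists_eq_pow (-1)
  have hj0 : j ≠ 0 := by
    rintro rfl
    exact ZMod.neg_one_ne_one (by simpa using hj)
  exact (isUnit_pow_iff hj0).1 (hj ▸ Units.isUnit _)

theorem orderOf_eq (hγ : IsPrimitiveRootModulo γ m) (hm : 2 < m) :
    orderOf (γ : ZMod m) = m.totient := by
  have : NeZero m := ⟨by omega⟩
  obtain ⟨u, hu⟩ := hγ.isUnit hm
  have hgen (x : (ZMod m)ˣ) : x ∈ Subgroup.zpowers u := by
    obtain ⟨j, hj⟩ := hγ.exists_eq_pow x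
    exact ⟨j, Units.ext (by simp only [zpow_natCast, Units.val_pow_eq_pow_val, hu, hj])⟩
  rw [← hu, orderOf_units, orderOf_eq_card_of_forall_mem_zpowers hgen, Nat.card_eq_fintype_card,
    ZMod.card_units_eq_totient]

theorem extractsLinear {p n : ℕ} (hp : p.Prime) (hγ : IsPrimitiveRootModulo γ (p ^ n)) :
    ExtractsLinear (p - 1) (p ^ n) (γ ^ p ^ (n - 1)) := by
  rcases eq_or_ne n 0 with rfl | hn
  · intro d _ _
    simp only [pow_zero, Nat.cast_one, one_dvd]
  rcases hp.two_le.eq_or_lt with rfl | hp2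
  · exact fun d _ hd => absurd hd (by omega)
  have := Fact.mk hp
  have hγp := hγ.of_pow hn
  refine extractsLinear_of_isUnit ?_ fun j hj0 hj => ?_
  · obtain ⟨u, hu⟩ := isUnit_intCast_zmod_pow n (hγp.isUnit hp2)
    rw [Int.cast_pow, ← pow_mul, ← Nat.totient_prime_pow hp (Nat.pos_of_ne_zero hn), ← hu,
      ← Units.val_pow_eq_pow_val, ZMod.pow_totient, Units.val_one]
  · have hne : (γ : ZMod p) ^ j ≠ 1 := pow_ne_one_of_lt_orderOf hj0.ne'
      (by rwa [hγp.orderOf_eq hp2, Nat.totient_prime hp])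
    have h := isUnit_intCast_zmod_pow n (z := (γ ^ p ^ (n - 1)) ^ j - 1) (m := p) (by
      push_cast
      rw [ZMod.pow_card_pow]
      exact (sub_ne_zero.2 hne).isUnit)
    exact_mod_cast h

end IsPrimitiveRootModulo

/-! ### The quotient by the annihilator -/

theorem IsPreLieRing.of_biadditive {M : Type*} [inst : AddCommGroup M] {mul : M → M → M}
    (add_left : ∀ x y z, mul (x + y) z = mul x z + mul y z)
    (add_right : ∀ x y z, mul x (y + z) = mul x y + mul x z)
    (assoc_symm : ∀ x y z, mul (mul x y) z - mul x (mul y z) = mul (mul y x) z - mul y (mul x z)) :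
    IsPreLieRing mul :=
  ⟨{ inst with
      mul := mul
      left_distrib := add_right
      right_distrib := add_left
      zero_mul := fun x => (AddMonoidHom.mk' (mul · x) fun a b => add_left a b x).map_zero
      mul_zero := fun x => (AddMonoidHom.mk' (mul x) (add_right x)).map_zero
      assoc_symm' := assoc_symm }, rfl, fun _ _ => rfl⟩

theorem exists_quotient_op {G : Type*} [AddGroup G] {H : AddSubgroup G} (f : G → G → G)
    (hf : ∀ x x' y y' : G, (x : G ⧸ H) = x' → (y : G ⧸ H) = y' → (f x y : G ⧸ H) = f x' y') :
    ∃ op : G ⧸ H → G ⧸ H → G ⧸ H, ∀ x y : G, op x y = f x y :=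
  ⟨fun X Y => f X.out Y.out, fun _ _ =>
    hf _ _ _ _ (QuotientAddGroup.out_eq' _) (QuotientAddGroup.out_eq' _)⟩

namespace LeftBrace

variable {A : Type*} [LeftBrace A] {p k n m : ℕ} {ξ : ℤ}

/-- The embedding of `A / ann(p ^ i)` into `A` induced by multiplication by `p ^ i`. -/
def nsmulLift (p i : ℕ) : A ⧸ ann A p i →+ A :=
  QuotientAddGroup.kerLift (nsmulAddMonoidHom (α := A) (p ^ i))

theorem nsmulLift_mk (i : ℕ) (x : A) : nsmulLift p i (x : A ⧸ ann A p i) = p ^ i • x := rfl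

theorem nsmulLift_injective (p i : ℕ) : Function.Injective (nsmulLift (A := A) p i) :=
  QuotientAddGroup.kerLift_injective _

theorem astHom_sub_astHom_mem {I : AddSubgroup A} (hI : IsIdeal I) {a a' : A} (h : a - a' ∈ I)
    (y : A) : astHom a y - astHom a' y ∈ I := by
  have hx : a'⁻¹ * a ∈ I := by
    rw [inv_mul_eq]
    exact add_mem h (hI _ h _).2
  have hxy : astHom (a'⁻¹ * a) y ∈ I := (hI _ hx y).1
  have hdiff : astHom a - astHom a' =
      astHom (a'⁻¹ * a) + astHom a' * astHom (a'⁻¹ * a) := by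
    rw [sub_eq_iff_eq_add', ← add_assoc, ← astHom_mul, mul_inv_cancel_left]
  have hdiffy : astHom a y - astHom a' y = _ := DFunLike.congr_fun hdiff y
  rw [hdiffy]
  exact add_mem hxy (hI _ hxy _).2

theorem nsmul_ast_congr (hann : IsIdeal (ann A p k))
    (hsub : ∀ a ∈ pMultiples A p k, ∀ b ∈ ann A p (2 * k), ast a b ∈ ann A p k)
    {x x' y y' : A} (hx : p ^ (2 * k) • x = p ^ (2 * k) • x')
    (hy : p ^ (2 * k) • y = p ^ (2 * k) • y') :
    p ^ k • ast (p ^ k • x) y = p ^ k • ast (p ^ k • x') y' := by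
  have hleft : astHom (p ^ k • x) y - astHom (p ^ k • x') y ∈ ann A p k := by
    refine astHom_sub_astHom_mem hann ?_ y
    change p ^ k • (p ^ k • x - p ^ k • x') = 0
    rw [smul_sub, smul_smul, smul_smul, ← pow_add, ← two_mul, hx, sub_self]
  have hright : astHom (p ^ k • x') (y - y') ∈ ann A p k := by
    refine hsub _ ⟨x', rfl⟩ _ ?_
    change p ^ (2 * k) • (y - y') = 0
    rw [smul_sub, hy, sub_self]
  have h := add_mem hleft hright
  rw [map_sub, sub_add_sub_cancel] at h
  change p ^ k • (ast (p ^ k • x) y - ast (p ^ k • x') y') = 0 at h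
  rwa [smul_sub, sub_eq_zero] at h

theorem nsmul_linAst_eq
    (hsub : ∀ a ∈ pMultiples A p k, ∀ b ∈ ann A p (2 * k), ast a b ∈ ann A p k)
    {a d v : A} (ha : a ∈ pMultiples A p k) (hd : d ∈ pMultiples A p k)
    (h : p ^ (2 * k) • v = p ^ k • d) : p ^ k • linAst m ξ a v = linAst m ξ a d := by
  obtain ⟨d, rfl⟩ := hd
  change p ^ (2 * k) • v = p ^ k • p ^ k • d at h
  change _ = linAst m ξ a (p ^ k • d)
  rw [map_nsmul, ← sub_eq_zero, ← smul_sub, ← map_sub, linAst_apply]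
  refine twistedAvg_mem (H := ann A p k) fun s => hsub _ (zsmul_mem ha s) _ ?_
  change p ^ (2 * k) • (v - d) = 0
  rw [smul_sub, h, smul_smul, ← pow_add, ← two_mul, sub_self]

theorem nsmulLift_sum_zsmul_odot
    {odot : A ⧸ ann A p (2 * k) → A ⧸ ann A p (2 * k) → A ⧸ ann A p (2 * k)}
    (hodot : ∀ x y : A, nsmulLift p (2 * k) (odot x y) = p ^ k • ast (p ^ k • x) y) (x y : A) :
    nsmulLift p (2 * k)
        (∑ i ∈ Finset.range m, ξ ^ (m - i) • odot (QuotientAddGroup.mk (ξ ^ i • x)) y) =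
      p ^ k • linAst m ξ (p ^ k • x) y := by
  rw [linAst_apply, ← nsmulAddMonoidHom_apply, map_twistedAvg]
  refine (map_twistedAvg _ fun s => odot (QuotientAddGroup.mk (s • x)) y).trans ?_
  simp only [hodot, nsmulAddMonoidHom_apply, smul_comm (p ^ k)]

section Bullet

variable {F : ℕ → AddSubgroup A} (hF : IsBraceFiltration F) (hp : p.Prime)
  (hA : ∀ x : A, p ^ n • x = 0) (hbot : F (p - 1) = ⊥) (hξ : ExtractsLinear (p - 1) (p ^ n) ξ)
  (hF1 : F 1 = pMultiples A p k)
  (hsub : ∀ a ∈ pMultiples A p k, ∀ b ∈ ann A p (2 * k), ast a b ∈ ann A p k)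
  {bullet : A ⧸ ann A p (2 * k) → A ⧸ ann A p (2 * k) → A ⧸ ann A p (2 * k)}
  (hbullet : ∀ x y : A,
    nsmulLift p (2 * k) (bullet x y) = p ^ k • linAst (p - 1) ξ (p ^ k • x) y)

include hF hp hA hbot hξ hF1 hsub hbullet

theorem nsmulLift_bullet_assoc (x y z : A) :
    nsmulLift p (2 * k) (bullet (bullet x y) z - bullet x (bullet y z)) =
      (linAst (p - 1) ξ (linAst (p - 1) ξ (p ^ k • x) (p ^ k • y)) -
        linAst (p - 1) ξ (p ^ k • x) * linAst (p - 1) ξ (p ^ k • y)) z := by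
  have hmem (x : A) : p ^ k • x ∈ F 1 := hF1 ▸ ⟨x, rfl⟩
  obtain ⟨w, hw⟩ := QuotientAddGroup.mk_surjective (bullet x y)
  obtain ⟨v, hv⟩ := QuotientAddGroup.mk_surjective (bullet y z)
  have hpw : p ^ k • p ^ k • w = linAst (p - 1) ξ (p ^ k • x) (p ^ k • y) := by
    rw [smul_smul, ← pow_add, ← two_mul, ← nsmulLift_mk, hw, hbullet, map_nsmul]
  have hpv : p ^ (2 * k) • v = p ^ k • linAst (p - 1) ξ (p ^ k • y) z := by
    rw [← nsmulLift_mk, hv, hbullet]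
  have hz : linAst (p - 1) ξ (p ^ k • y) z ∈ F 1 :=
    hF.linAst_mem (hmem y) 0 z (hF.zero_eq_top ▸ AddSubgroup.mem_top z)
  rw [← hw, ← hv, map_sub, hbullet, hbullet, ← hpw,
    hF.linAst_nsmul hp hA hbot hξ (hmem w),
    nsmul_linAst_eq hsub (hF1 ▸ hmem x) (hF1 ▸ hz) hpv]
  rfl

theorem isPreLieRing_of_nsmulLift_eq : IsPreLieRing bullet := by
  have hmem (x : A) : p ^ k • x ∈ F 1 := hF1 ▸ ⟨x, rfl⟩
  refine .of_biadditive ?_ ?_ ?_ <;> refine fun X Y Z => nsmulLift_injective p (2 * k) ?_ <;>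
    induction X using QuotientAddGroup.induction_on with | H x <;>
    induction Y using QuotientAddGroup.induction_on with | H y <;>
    induction Z using QuotientAddGroup.induction_on with | H z
  · rw [← QuotientAddGroup.mk_add, map_add, hbullet, hbullet, hbullet, smul_add,
      hF.linAst_add hp hA hbot hξ (hmem x) (hmem y), ← smul_add]
    rfl
  · rw [← QuotientAddGroup.mk_add, map_add, hbullet, hbullet, hbullet, map_add, smul_add]
  · have hassoc := nsmulLift_bullet_assoc hF hp hA hbot hξ hF1 hsub hbullet
    rw [hassoc, hassoc, hF.linAst_linAst_sub_symm hp hA hbot hξ (hmem x) (hmem y)]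

end Bullet

end LeftBrace

open LeftBrace in
theorem mainTheorem3_general {A : Type*} [LeftBrace A] (p n k : ℕ) (hp : p.Prime)
    (hA : ∀ x : A, p ^ n • x = 0)
    (hk : pMultiples A p (k * (p - 1)) = ⊥)
    (hpow : ∀ i : ℕ, k ∣ i → IsIdeal (pMultiples A p i))
    (hann : IsIdeal (ann A p k))
    (hsub : ∀ a ∈ pMultiples A p k, ∀ b ∈ ann A p (2 * k), ast a b ∈ ann A p k)
    (pullback : pMultiples A p k → A)
    (hpullback : ∀ a : pMultiples A p k, p ^ k • pullback a = (a : A))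
    (ξ : ℤ) (hξ : ExtractsLinear (p - 1) (p ^ n) ξ) :
    ∃ odot : A ⧸ ann A p (2 * k) → A ⧸ ann A p (2 * k) → A ⧸ ann A p (2 * k),
      (∀ x y : A, odot (QuotientAddGroup.mk x) (QuotientAddGroup.mk y) =
        QuotientAddGroup.mk
          (pullback ⟨ast (p ^ k • x) y, (hpow k dvd_rfl _ ⟨x, rfl⟩ y).1⟩)) ∧
      ∃ bullet : A ⧸ ann A p (2 * k) → A ⧸ ann A p (2 * k) → A ⧸ ann A p (2 * k),
        (∀ x y : A, bullet (QuotientAddGroup.mk x) (QuotientAddGroup.mk y) =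
          ∑ i ∈ Finset.range (p - 1),
            ξ ^ (p - 1 - i) • odot (QuotientAddGroup.mk (ξ ^ i • x)) (QuotientAddGroup.mk y)) ∧
        IsPreLieRing bullet := by
  have hpull (a) : nsmulLift p (2 * k) (QuotientAddGroup.mk (pullback a)) = p ^ k • (a : A) := by
    rw [nsmulLift_mk, two_mul, pow_add, mul_smul, hpullback]
  obtain ⟨odot, hodot⟩ := exists_quotient_op (H := ann A p (2 * k))
    (fun x y => pullback ⟨ast (p ^ k • x) y, (hpow k dvd_rfl _ ⟨x, rfl⟩ y).1⟩)
    fun x x' y y' hx hy => nsmulLift_injective p (2 * k) <| by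
      rw [hpull, hpull]
      exact nsmul_ast_congr hann hsub (congrArg (nsmulLift p (2 * k)) hx)
        (congrArg (nsmulLift p (2 * k)) hy)
  refine ⟨odot, hodot, fun X Y => ∑ i ∈ Finset.range (p - 1), ξ ^ (p - 1 - i) • odot (ξ ^ i • X) Y,
    fun _ _ => rfl, ?_⟩
  refine isPreLieRing_of_nsmulLift_eq (isBraceFiltration_pMultiples hpow) hp hA hk hξ
    (congrArg (pMultiples A p) (mul_one k)) hsub fun x y => ?_
  exact nsmulLift_sum_zsmul_odot (fun x y => by rw [hodot, hpull]) x y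

theorem mainTheorem3 {A : Type*} [LeftBrace A] (p n k : ℕ) (hp : p.Prime)
    (hcard : Nat.card A = p ^ n)
    (hk : LeftBrace.pMultiples A p (k * (p - 1)) = ⊥)
    (hpow : ∀ i : ℕ, LeftBrace.IsIdeal (LeftBrace.pMultiples A p i))
    (hann : ∀ i : ℕ, LeftBrace.IsIdeal (LeftBrace.ann A p i))
    (hsub : ∀ a ∈ LeftBrace.pMultiples A p k, ∀ b ∈ LeftBrace.ann A p (2 * k),
      LeftBrace.ast a b ∈ LeftBrace.ann A p k)
    -- the pullback `℘⁻¹ : p ^ k A → A`, an arbitrary choice of `p ^ k`-th parts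
    (pullback : LeftBrace.pMultiples A p k → A)
    (hpullback : ∀ a : LeftBrace.pMultiples A p k, p ^ k • pullback a = (a : A))
    (γ ξ : ℤ) (hγ : IsPrimitiveRootModulo γ (p ^ n)) (hξ : ξ = γ ^ p ^ (n - 1)) :
    ∃ odot : A ⧸ LeftBrace.ann A p (2 * k) → A ⧸ LeftBrace.ann A p (2 * k) →
        A ⧸ LeftBrace.ann A p (2 * k),
      (∀ x y : A, odot (QuotientAddGroup.mk x) (QuotientAddGroup.mk y) =
        QuotientAddGroup.mk
          (pullback ⟨LeftBrace.ast (p ^ k • x) y, (hpow k _ ⟨x, rfl⟩ y).1⟩)) ∧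
      ∃ bullet : A ⧸ LeftBrace.ann A p (2 * k) → A ⧸ LeftBrace.ann A p (2 * k) →
          A ⧸ LeftBrace.ann A p (2 * k),
        (∀ x y : A, bullet (QuotientAddGroup.mk x) (QuotientAddGroup.mk y) =
          ∑ i ∈ Finset.range (p - 1),
            ξ ^ (p - 1 - i) • odot (QuotientAddGroup.mk (ξ ^ i • x)) (QuotientAddGroup.mk y)) ∧
        IsPreLieRing bullet := by
  have hA (x : A) : p ^ n • x = 0 := by
    rw [← hcard]
    exact card_nsmul_eq_zero'
  subst hξ
  exact mainTheorem3_general p n k hp hA hk (fun i _ => hpow i) (hann k) hsub pullback hpullback _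
    (hγ.extractsLinear hp)
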